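/- **Proposition 5.2** (with the remark that completes it). For $j\ge 1$ let $V_j\cong(\mathbb Z/2)^j$ denote the permutation group on $2^j$ letters given by the regular representation of $(\mathbb Z/2)^j$, and let $E_k$ be the group of even permutations contained in $V_1^k$, acting on $2k$ letters ($k$ disjoint pairs). For a finitely supported sequence $i=(i_1,i_2,\dots,i_r,0,0,\dots)$ of non-negative integers put $|i|=2i_1+4i_2+\cdots+2^r i_r$. A subgroup of $S_n$ is *of the form* $$E_{i_1}\times V_2^{i_2}\times\cdots\times V_r^{i_r}$$ if, for some choice of $|i|$ of the $n$ letters, it is this product acting on the chosen letters (each factor on its own block of letters) and fixing the remaining ones. Since $E_1$ is trivial, only forms with $i_1\neq 1$ are used. The trivial group counts as elementary abelian. Let $n\ge 0$. 1. Let $A$ be a maximal elementary abelian $2$-subgroup of $A_n$. Then there is $i$ with $i_1\ne 1$ such that $A$ is conjugate in $A_n$ to a subgroup of the form $E_{i_1}\times V_2^{i_2}\times\cdots\times V_r^{i_r}$, and $A$ is conjugate in $S_n$ to every subgroup of this form. The number of letters moved by $A$ is $|i|=2i_1+4i_2+\cdots+2^ri_r$, and it is $n$, $n-1$, $n-2$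 or $n-3$. 2. Let $i\neq 0$ with $i_1=i_2=0$, and let $A\le S_n$ be of the form $V_3^{i_3}\times\cdots\times V_r^{i_r}$. If $n\in\{|i|,|i|+1\}$, then $A$ is a maximal elementary abelian $2$-subgroup of $S_n$, and its $S_n$-conjugacy class is the union of exactly two $A_n$-conjugacy classes. If $n\in\{|i|,|i|+1,|i|+2,|i|+3\}$, then $A$ is a maximal elementary abelian $2$-subgroup of $A_n$. 3. Let $A$ and $B$ be maximal elementary abelian $2$-subgroups of $A_n$ of the forms given by $i$ and $k$ respectively, with $i_1\ne1$ and $k_1\neq 1$, neither of which is of the type for which part 2 gives a splitting (that is, neither form is nonzero with first two multiplicities $0$ and letter count $n$ or $n-1$). Then $A$ and $B$ are conjugate in $A_n$ if and only if $i=k$. -/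

import Mathlib

/-- `E` is an elementary abelian `2`-group: commutative, and every element squares to `1`. -/
def IsElementaryAbelianTwo {G : Type*} [Group G] (E : Subgroup G) : Prop :=
  (∀ x ∈ E, ∀ y ∈ E, x * y = y * x) ∧ ∀ x ∈ E, x ^ 2 = 1

/-- `E` is a maximal elementary abelian `2`-subgroup of the subgroup `H` of `G`. -/
def IsMaxElementaryAbelianTwo {G : Type*} [Group G] (H E : Subgroup G) : Prop :=
  Maximal (fun F : Subgroup G => F ≤ H ∧ IsElementaryAbelianTwo F) E

/-- `A` and `B` are conjugate by an element of the subgroup `H` of `G`. -/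
def ConjugateIn {G : Type*} [Group G] (H A B : Subgroup G) : Prop :=
  ∃ g ∈ H, A.map (MulAut.conj g).toMonoidHom = B

/-- The conjugacy class of `A` in `G` is the disjoint union of exactly two classes under
conjugation by elements of `H`. -/
def ClassSplitsInTwo {G : Type*} [Group G] (H A : Subgroup G) : Prop :=
  ∃ B C : Subgroup G, ConjugateIn ⊤ A B ∧ ConjugateIn ⊤ A C ∧ ¬ ConjugateIn H B C ∧
    ∀ D : Subgroup G, ConjugateIn ⊤ A D → ConjugateIn H B D ∨ ConjugateIn H C D

/-- The elementary abelian group of order `2 ^ j`, written multiplicatively. -/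
abbrev VGroup (j : ℕ) : Type := Multiplicative (Fin j → ZMod 2)

/-- The permutation group `V_j`: the regular representation of the elementary abelian group of
order `2 ^ j`, acting on its own `2 ^ j` elements. -/
def regularV (j : ℕ) : Subgroup (Equiv.Perm (VGroup j)) :=
  (MulAction.toPermHom (VGroup j) (VGroup j)).range

/-- The direct product of permutation groups `H a` on `β a`, acting on the disjoint union
of the sets `β a`. -/
def permProd {ι : Type*} {β : ι → Type*} (H : ∀ a, Subgroup (Equiv.Perm (β a))) :
    Subgroup (Equiv.Perm (Σ a, β a)) :=
  (Subgroup.pi Set.univ H).map (Equiv.Perm.sigmaCongrRightHom β)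

/-- `V_j ^ k`, acting on `k` disjoint copies of the set of `2 ^ j` letters. -/
def powV (j k : ℕ) : Subgroup (Equiv.Perm (Σ _ : Fin k, VGroup j)) :=
  permProd fun _ => regularV j

/-- The factor with index `j` of a product `E_{i_1} × V_2 ^ {i_2} × ⋯ × V_r ^ {i_r}`, with
multiplicity `k = i_j`: for `j = 1` it is the group `E_k` of even permutations in `V_1 ^ k`,
and for `j ≥ 2` it is `V_j ^ k`. -/
def factorV (j k : ℕ) : Subgroup (Equiv.Perm (Σ _ : Fin k, VGroup j)) :=
  if j = 1 then powV j k ⊓ alternatingGroup (Σ _ : Fin k, VGroup j) else powV j k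

/-- The letters on which `E_{i_1} × V_2 ^ {i_2} × ⋯ × V_r ^ {i_r}` acts. A form is a finitely
supported sequence `i = (i_1, i_2, …)` of multiplicities. -/
abbrev Letters (i : ℕ+ →₀ ℕ) : Type := Σ j : ℕ+, Σ _ : Fin (i j), VGroup j

/-- The number `2 i_1 + 4 i_2 + ⋯ + 2 ^ r i_r`. -/
def letterCount (i : ℕ+ →₀ ℕ) : ℕ := i.sum fun j k => 2 ^ (j : ℕ) * k

/-- The permutation group `E_{i_1} × V_2 ^ {i_2} × ⋯ × V_r ^ {i_r}` on its own letters. -/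
def modelGroup (i : ℕ+ →₀ ℕ) : Subgroup (Equiv.Perm (Letters i)) :=
  permProd fun j : ℕ+ => factorV j (i j)

/-- The subgroup `E_{i_1} × V_2 ^ {i_2} × ⋯ × V_r ^ {i_r}` of `S_n` whose letters are placed
among `1, …, n` by the injection `φ`; the letters outside the image of `φ` are fixed. -/
noncomputable def placedGroup {n : ℕ} (i : ℕ+ →₀ ℕ) (φ : Letters i ↪ Fin n) :
    Subgroup (Equiv.Perm (Fin n)) :=
  (modelGroup i).map (Equiv.Perm.viaEmbeddingHom φ)

/-- The subgroup `A` of `S_n` is of the form `E_{i_1} × V_2 ^ {i_2} × ⋯ × V_r ^ {i_r}`. -/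
def HasForm {n : ℕ} (i : ℕ+ →₀ ℕ) (A : Subgroup (Equiv.Perm (Fin n))) : Prop :=
  ∃ φ : Letters i ↪ Fin n, A = placedGroup i φ

/-- The set of letters moved by `A`. -/
def movedLetters {n : ℕ} (A : Subgroup (Equiv.Perm (Fin n))) : Set (Fin n) :=
  {x | ∃ g ∈ A, g x ≠ x}

/-- The form is a nonempty product `V_3 ^ {i_3} × ⋯ × V_r ^ {i_r}`, and the number of its letters
is `n` or `n - 1`. -/
def IsSplittingForm (n : ℕ) (i : ℕ+ →₀ ℕ) : Prop :=
  i ≠ 0 ∧ i 1 = 0 ∧ i 2 = 0 ∧ (n = letterCount i ∨ n = letterCount i + 1)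

open Equiv

/-! Let `A` be an elementary abelian 2-subgroup of `A_n`. On each orbit `A` acts through its
quotient by a point stabilizer, which acts regularly, so the orbit is a copy of some `VGroup j` on
which `A` translates. Hence `A` lies in the group of all translations of its nontrivial orbits,
intersected with `A_n`. A translation of `VGroup j` is even for `j ≥ 2`, so evenness constrains only
the blocks of size two, and this intersection is exactly a placed group (`placedGroup_eq`,
`exists_placement`). Maximality forces equality. A lone block of size two could not be an orbit,
because the element swapping it would be odd. Four fixed letters would allow a further double
transposition. Orbit sizes recover the form (`ncard_orbit_eq`).

For the remark, a permutation commuting with all block translations is itself a translation on each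
block. What remains is an involution on the few fixed letters, which must be trivial
(`isMax_placedGroup`).

An `S_n`-class splits in `A_n` when odd permutations exist but none normalizes the group. With all
blocks of rank at least 3 and at most one fixed letter, a normalizing permutation is a permutation
of blocks composed with affine maps of the blocks. Both are even, by one criterion,
`sign_eq_one_of_commute_flip`: each block permutation and each generator of the linear groups
commutes with an involution exchanging two halves that it preserves. Otherwise an odd normalizing
element exists: a translation of a block of two letters, a transposition in a block of four
(`AGL_2(2) = S_4`), or a transposition of two fixed letters. The trivial form with `n ≤ 1` is
immediate. -/

/-! ### Signs of extended permutations and of disjoint unions -/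

theorem sign_viaEmbedding {α β : Type*} [Fintype α] [DecidableEq α] [Fintype β] [DecidableEq β]
    (ψ : α ↪ β) (e : Perm α) : Perm.sign (e.viaEmbedding ψ) = Perm.sign e := by
  classical
  rw [Perm.viaEmbedding, ← Perm.sign_extendDomain e (Equiv.ofInjective ψ.1 ψ.2)]
  congr!

theorem eq_viaEmbedding {α β : Type*} (ψ : α ↪ β) (e : Perm α) (x : Perm β)
    (h : ∀ a, x (ψ a) = ψ (e a)) (h' : ∀ y ∉ Set.range ψ, x y = y) : x = e.viaEmbedding ψ := by
  ext y
  by_cases hy : y ∈ Set.range ψ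
  · obtain ⟨a, rfl⟩ := hy
    rw [h, Perm.viaEmbedding_apply]
  · rw [h' y hy, Perm.viaEmbedding_apply_of_notMem _ _ _ hy]

theorem sign_sigmaCongrRight {ι : Type*} [Fintype ι] [DecidableEq ι] {β : ι → Type*}
    [∀ a, Fintype (β a)] [∀ a, DecidableEq (β a)] (F : ∀ a, Perm (β a)) :
    Perm.sign (Perm.sigmaCongrRight F) = ∏ a, Perm.sign (F a) := by
  -- Induction on a finite set containing the indices where the family is nontrivial; resetting one
  -- member to `1` peels off a permutation supported on a single summand.
  suffices H : ∀ (s : Finset ι) (F : ∀ a, Perm (β a)), (∀ a ∉ s, F a = 1) →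
      Perm.sign (Perm.sigmaCongrRight F) = ∏ a ∈ s, Perm.sign (F a) from
    H Finset.univ F (by simp)
  intro s
  induction s using Finset.induction_on with
  | empty =>
    intro F hF
    have : F = 1 := funext fun a => hF a (by simp)
    rw [this, Perm.sigmaCongrRight_one]
    simp
  | insert a s ha ih =>
    intro F hF
    have h1 : Perm.sigmaCongrRight F = Perm.sigmaCongrRight (Function.update F a 1) *
        (F a).viaEmbedding (Function.Embedding.sigmaMk (β := β) a) := by
      have h2 : (F a).viaEmbedding (Function.Embedding.sigmaMk (β := β) a) =
          Perm.sigmaCongrRight (Pi.mulSingle a (F a)) := by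
        symm
        apply eq_viaEmbedding
        · intro p
          simp [Function.Embedding.sigmaMk]
        · rintro ⟨b, p⟩ hb
          have hba : b ≠ a := by
            rintro rfl
            exact hb ⟨p, rfl⟩
          simp [Pi.mulSingle_eq_of_ne hba]
      rw [h2]
      refine Eq.trans ?_ (Perm.sigmaCongrRight_mul _ _).symm
      congr 1
      ext b : 1
      by_cases hb : b = a
      · subst hb
        simp
      · simp [Function.update_of_ne hb, Pi.mulSingle_eq_of_ne hb]
    rw [h1, map_mul, sign_viaEmbedding, Finset.prod_insert ha, ih, mul_comm]
    · congr 1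
      refine Finset.prod_congr rfl fun b hb => ?_
      rw [Function.update_of_ne (by rintro rfl; exact ha hb)]
    · intro b hb
      by_cases hba : b = a
      · subst hba
        simp
      · rw [Function.update_of_ne hba]
        exact hF b (by simp [hba, hb])

/-- A permutation that preserves both halves of a set and commutes with an involution
exchanging them is even. -/
theorem sign_eq_one_of_commute_flip {α : Type*} [Fintype α] [DecidableEq α] (σ T : Perm α)
    (f : α → ZMod 2) (hf : ∀ x, f (σ x) = f x) (hT : ∀ x, f (T x) = f x + 1)
    (hσ : ∀ x, σ (T x) = T (σ x)) : Perm.sign σ = 1 := by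
  classical
  have hp : ∀ x, f (σ x) = 0 ↔ f x = 0 := fun x => by rw [hf]
  have hq : ∀ x, ¬ f (σ x) = 0 ↔ ¬ f x = 0 := fun x => by rw [hf]
  have hTT : ∀ x, f x = 0 ↔ ¬ f (T x) = 0 := by
    intro x
    rw [hT]
    generalize f x = a
    revert a
    decide
  have key : σ = Perm.subtypeCongr (σ.subtypePerm (p := fun x => f x = 0) hp)
      (σ.subtypePerm (p := fun x => ¬ f x = 0) hq) := by
    ext x
    by_cases hx : f x = 0
    · rw [Perm.subtypeCongr.left_apply (p := fun x => f x = 0) _ _ hx]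
      rfl
    · rw [Perm.subtypeCongr.right_apply (p := fun x => f x = 0) _ _ hx]
      rfl
  -- `T` carries the restriction of `σ` on one half to that on the other, so the two signs agree and
  -- their product is a square in `{1, -1}`.
  have h2 : Perm.sign (σ.subtypePerm (p := fun x => f x = 0) hp) =
      Perm.sign (σ.subtypePerm (p := fun x => ¬ f x = 0) hq) := by
    apply Perm.sign_eq_sign_of_equiv _ _ (T.subtypeEquiv hTT)
    rintro ⟨x, hx⟩
    ext
    exact (hσ x).symm
  rw [key, Perm.sign_subtypeCongr, h2]
  exact Int.units_mul_self _

/-! ### Parity of affine maps over the field with two elements -/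

/-- The translations of the elementary abelian group of order `2 ^ j`. -/
abbrev translation {j : ℕ} (v : VGroup j) : Perm (VGroup j) :=
  MulAction.toPermHom (VGroup j) (VGroup j) v

theorem VGroup.mul_self {j : ℕ} (v : VGroup j) : v * v = 1 := by
  apply Multiplicative.toAdd.injective
  ext a
  exact CharTwo.add_self_eq_zero _

theorem sign_translation {j : ℕ} (hj : 2 ≤ j) (v : VGroup j) :
    Perm.sign (translation v) = 1 := by
  classical
  -- A nonzero functional vanishing on `v` defines the two halves, and translation by `w` exchanges
  -- them. Among two coordinates and their sum, one vanishes on `v`; two coordinates exist because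
  -- `j ≥ 2`.
  obtain ⟨g, w, hgv, hgw⟩ : ∃ (g : (Fin j → ZMod 2) →+ ZMod 2) (w : Fin j → ZMod 2),
      g (Multiplicative.toAdd v) = 0 ∧ g w = 1 := by
    set u := Multiplicative.toAdd v
    let a : Fin j := ⟨0, by omega⟩
    let b : Fin j := ⟨1, by omega⟩
    have hab : a ≠ b := by simp [a, b]
    have two : ∀ t : ZMod 2, t = 0 ∨ t = 1 := by decide
    rcases two (u a) with h | h
    · exact ⟨Pi.evalAddMonoidHom (fun _ : Fin j => ZMod 2) a, Pi.single a 1, h, by simp⟩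
    · rcases two (u b) with h' | h'
      · exact ⟨Pi.evalAddMonoidHom (fun _ : Fin j => ZMod 2) b, Pi.single b 1, h', by simp⟩
      · refine ⟨Pi.evalAddMonoidHom (fun _ : Fin j => ZMod 2) a + Pi.evalAddMonoidHom (fun _ : Fin j => ZMod 2) b, Pi.single a 1, ?_, ?_⟩
        · simp only [AddMonoidHom.add_apply, Pi.evalAddMonoidHom_apply, h, h']
          decide
        · simp [hab.symm]
  refine sign_eq_one_of_commute_flip _ (translation (Multiplicative.ofAdd w))
    (fun p => g (Multiplicative.toAdd p)) ?_ ?_ ?_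
  · intro p
    simp [hgv]
  · intro p
    simp [hgw, add_comm]
  · intro p
    simp [mul_left_comm]

theorem sign_translation_one {v : VGroup 1} (hv : v ≠ 1) : Perm.sign (translation v) = -1 := by
  revert v
  decide

/-- Over `ZMod 2` an invertible diagonal matrix is the identity, so transvections generate. A
transvection involves only two coordinates; since `d ≥ 3` there is a third, `l`, and translation by
the `l`-th basis vector is a commuting flip. -/
theorem sign_mulVec {d : ℕ} (hd : 3 ≤ d) (M : Matrix (Fin d) (Fin d) (ZMod 2)) (hM : M.det ≠ 0) :
    ∀ σ : Perm (Fin d → ZMod 2), (∀ p, σ p = M.mulVec p) → Perm.sign σ = 1 := by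
  classical
  have two : ∀ t : ZMod 2, t ≠ 0 → t = 1 := by decide
  refine Matrix.diagonal_transvection_induction_of_det_ne_zero
    (fun M => ∀ σ : Perm (Fin d → ZMod 2), (∀ p, σ p = M.mulVec p) → Perm.sign σ = 1) M hM ?_ ?_ ?_
  · intro D hD σ hσ
    have hD1 : D = 1 := by
      ext a : 1
      rw [Matrix.det_diagonal, Finset.prod_ne_zero_iff] at hD
      exact two _ (hD a (Finset.mem_univ _))
    have : σ = 1 := by
      ext1 p
      rw [hσ, hD1]
      simp
    simp [this]
  · rintro ⟨a, b, hab, c⟩ σ hσ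
    obtain ⟨l, hla, hlb⟩ : ∃ l : Fin d, l ≠ a ∧ l ≠ b := by
      have : 2 < Fintype.card (Fin d) := by rw [Fintype.card_fin]; omega
      obtain ⟨l, hl⟩ := Finset.exists_mem_notMem_of_card_lt_card
        (s := {a, b}) (t := Finset.univ) (lt_of_le_of_lt Finset.card_le_two this)
      exact ⟨l, by simpa using hl⟩
    have hval : ∀ p, σ p = p + Pi.single a (c * p b) := by
      intro p
      rw [hσ]
      simp [Matrix.TransvectionStruct.toMatrix, Matrix.transvection, Matrix.add_mulVec,
        Matrix.single_mulVec]
      rfl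
    refine sign_eq_one_of_commute_flip σ (Equiv.addRight (Pi.single l 1)) (fun p => p l) ?_ ?_ ?_
    · intro p
      simp [hval, hla]
    · intro p
      simp
    · intro p
      simp [hval, hlb.symm]
      abel
  · intro A B hA hB iA iB σ hσ
    have hperm : ∀ C : Matrix (Fin d) (Fin d) (ZMod 2), C.det ≠ 0 →
        ∃ τ : Perm (Fin d → ZMod 2), ∀ p, τ p = C.mulVec p := by
      intro C hC
      have hu : IsUnit C := (Matrix.isUnit_iff_isUnit_det C).2 hC.isUnit
      have : Function.Bijective C.mulVec :=
        Finite.injective_iff_bijective.1 (Matrix.mulVec_injective_iff_isUnit.2 hu)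
      exact ⟨Equiv.ofBijective _ this, fun p => rfl⟩
    obtain ⟨α, hα⟩ := hperm A hA
    obtain ⟨β, hβ⟩ := hperm B hB
    have : σ = α * β := by
      ext1 p
      rw [hσ, Perm.mul_apply, hα, hβ, Matrix.mulVec_mulVec]
    rw [this, map_mul, iA α hα, iB β hβ, one_mul]

/-- Such an `h` is affine: dividing by `h 1` gives an additive, hence linear, bijection `L`, and the
translation divided out is even. -/
theorem sign_of_normalizes_translations {d : ℕ} (hd : 3 ≤ d) (h : Perm (VGroup d))
    (H : ∀ v, ∃ v', ∀ p, h (v * p) = v' * h p) : Perm.sign h = 1 := by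
  classical
  let L : Perm (Fin d → ZMod 2) := Multiplicative.toAdd.permCongr (translation (h 1)⁻¹ * h)
  have hL : ∀ p, L p = Multiplicative.toAdd ((h 1)⁻¹ * h (Multiplicative.ofAdd p)) := by
    intro p
    rfl
  have hadd : ∀ p q, L (p + q) = L p + L q := by
    intro p q
    rw [hL, hL, hL, ofAdd_add]
    obtain ⟨v', hv⟩ := H (Multiplicative.ofAdd p)
    have h1 := hv 1
    rw [mul_one] at h1
    rw [hv, h1, ← toAdd_mul]
    congr 1
    rw [mul_comm v' (h 1), inv_mul_cancel_left]
    exact mul_left_comm _ _ _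
  let L' : (Fin d → ZMod 2) →ₗ[ZMod 2] (Fin d → ZMod 2) :=
    (AddMonoidHom.mk' L hadd).toZModLinearMap 2
  have hM : ∀ p, L p = (LinearMap.toMatrix' L').mulVec p := by
    intro p
    rw [LinearMap.toMatrix'_mulVec]
    rfl
  have hdet : (LinearMap.toMatrix' L').det ≠ 0 := by
    have : IsUnit (LinearMap.toMatrix' L') := by
      rw [← Matrix.mulVec_injective_iff_isUnit]
      intro p q hpq
      rw [← hM, ← hM] at hpq
      exact L.injective hpq
    exact ((Matrix.isUnit_iff_isUnit_det _).1 this).ne_zero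
  have h1 := sign_mulVec hd _ hdet L hM
  rw [Perm.sign_permCongr, map_mul, sign_translation (by omega), one_mul] at h1
  exact h1

/-! ### Block translations -/

/-- Translations of the blocks `VGroup (d k)`, which are embedded disjointly in `α`. The points
outside the blocks are fixed. -/
noncomputable def blockPerm {K α : Type*} {d : K → ℕ} (ψ : (Σ k, VGroup (d k)) ↪ α) :
    (∀ k, VGroup (d k)) →* Perm α :=
  (Perm.viaEmbeddingHom ψ).comp ((Perm.sigmaCongrRightHom fun k => VGroup (d k)).comp
    (MonoidHom.pi fun k => (MulAction.toPermHom (VGroup (d k)) (VGroup (d k))).comp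
      (Pi.evalMonoidHom _ k)))

section
variable {K α : Type*} {d : K → ℕ} (ψ : (Σ k, VGroup (d k)) ↪ α)

theorem blockPerm_eq (v : ∀ k, VGroup (d k)) :
    blockPerm ψ v = (Perm.sigmaCongrRight fun k => translation (v k)).viaEmbedding ψ := rfl

theorem blockPerm_apply (v : ∀ k, VGroup (d k)) (k : K) (p : VGroup (d k)) :
    blockPerm ψ v (ψ ⟨k, p⟩) = ψ ⟨k, v k * p⟩ := by
  rw [blockPerm_eq, Perm.viaEmbedding_apply]
  rfl

theorem blockPerm_apply_of_notMem (v : ∀ k, VGroup (d k)) {y : α} (hy : y ∉ Set.range ψ) :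
    blockPerm ψ v y = y :=
  Perm.viaEmbedding_apply_of_notMem _ _ _ hy

theorem eq_blockPerm (v : ∀ k, VGroup (d k)) (x : Perm α)
    (h : ∀ k p, x (ψ ⟨k, p⟩) = ψ ⟨k, v k * p⟩) (h' : ∀ y ∉ Set.range ψ, x y = y) :
    x = blockPerm ψ v :=
  eq_viaEmbedding _ _ _ (fun ⟨k, p⟩ => h k p) h'

theorem blockPerm_mul_self (v : ∀ k, VGroup (d k)) : blockPerm ψ v * blockPerm ψ v = 1 := by
  rw [← map_mul, ← map_one (blockPerm ψ)]
  congr 1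
  ext1 k
  exact VGroup.mul_self _

theorem blockPerm_conj (g : Perm α) (v : ∀ k, VGroup (d k)) :
    g * blockPerm ψ v * g⁻¹ = blockPerm (ψ.trans g.toEmbedding) v := by
  apply eq_blockPerm
  · intro k p
    simp [blockPerm_apply]
  · intro y hy
    have : g⁻¹ y ∉ Set.range ψ := by
      rintro ⟨a, ha⟩
      exact hy ⟨a, by simp [ha]⟩
    rw [Perm.mul_apply, Perm.mul_apply, blockPerm_apply_of_notMem _ _ this]
    exact g.apply_symm_apply y

theorem sign_blockPerm [Fintype α] [DecidableEq α] [Fintype K] (v : ∀ k, VGroup (d k)) :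
    Perm.sign (blockPerm ψ v) = ∏ k, Perm.sign (translation (v k)) := by
  classical
  rw [blockPerm_eq, sign_viaEmbedding, sign_sigmaCongrRight]

theorem sign_blockPerm_mulSingle [Fintype α] [DecidableEq α] [Finite K] [DecidableEq K] (k : K)
    (v : VGroup (d k)) :
    Perm.sign (blockPerm ψ (Pi.mulSingle k v)) = Perm.sign (translation v) := by
  have := Fintype.ofFinite K
  rw [sign_blockPerm, Finset.prod_eq_single k]
  · simp
  · intro b _ hb
    rw [Pi.mulSingle_eq_of_ne hb, translation, map_one, map_one]
  · simp

theorem isElementaryAbelianTwo_of_le_range {A : Subgroup (Perm α)}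
    (hA : A ≤ (blockPerm ψ).range) : IsElementaryAbelianTwo A := by
  constructor
  · intro x hx y hy
    obtain ⟨v, rfl⟩ := hA hx
    obtain ⟨w, rfl⟩ := hA hy
    rw [← map_mul, ← map_mul, mul_comm]
  · intro x hx
    obtain ⟨v, rfl⟩ := hA hx
    rw [sq, blockPerm_mul_self]

end

/-! ### Placed groups as even block translations -/

/-- The blocks of a form. -/
abbrev Blocks (i : ℕ+ →₀ ℕ) : Type := Σ j : ℕ+, Fin (i j)

instance (i : ℕ+ →₀ ℕ) : Fintype (Blocks i) :=
  ⟨i.support.sigma fun _ => Finset.univ, by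
    rintro ⟨j, m⟩
    have : i j ≠ 0 := by
      intro h
      rw [h] at m
      exact m.elim0
    simpa using this⟩

instance (i : ℕ+ →₀ ℕ) : Fintype (Letters i) :=
  ⟨i.support.sigma fun _ => Finset.univ, by
    rintro ⟨j, m, p⟩
    have : i j ≠ 0 := by
      intro h
      rw [h] at m
      exact m.elim0
    simpa using this⟩

theorem card_letters (i : ℕ+ →₀ ℕ) : Fintype.card (Letters i) = letterCount i := by
  have : Fintype.card (Letters i) =
      (i.support.sigma fun j => (Finset.univ : Finset (Σ _ : Fin (i j), VGroup j))).card := rfl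
  rw [this, Finset.card_sigma, letterCount, Finsupp.sum]
  refine Finset.sum_congr rfl fun j _ => ?_
  simp [Finset.card_univ, mul_comm]

/-- The placement of the letters, block by block. -/
def blockEmb {i : ℕ+ →₀ ℕ} {α : Type*} (φ : Letters i ↪ α) :
    (Σ k : Blocks i, VGroup k.1) ↪ α :=
  (Equiv.sigmaAssoc fun (j : ℕ+) (_ : Fin (i j)) => VGroup j).toEmbedding.trans φ

theorem blockEmb_apply {i : ℕ+ →₀ ℕ} {α : Type*} (φ : Letters i ↪ α) (k : Blocks i)
    (p : VGroup k.1) : blockEmb φ ⟨k, p⟩ = φ ⟨k.1, k.2, p⟩ := rfl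

theorem blockEmb_trans {i : ℕ+ →₀ ℕ} {α β : Type*} (φ : Letters i ↪ α) (g : α ↪ β) :
    blockEmb (φ.trans g) = (blockEmb φ).trans g := rfl

theorem range_blockEmb {i : ℕ+ →₀ ℕ} {α : Type*} (φ : Letters i ↪ α) :
    Set.range (blockEmb φ) = Set.range φ := by
  ext y
  constructor
  · rintro ⟨⟨k, p⟩, rfl⟩
    exact ⟨_, rfl⟩
  · rintro ⟨⟨j, m, p⟩, rfl⟩
    exact ⟨⟨⟨j, m⟩, p⟩, rfl⟩

/-- Translations of blocks of rank at least two are even, so only blocks of size two contribute. -/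
theorem sign_blockPerm_blockEmb {i : ℕ+ →₀ ℕ} {α : Type*} [Fintype α] [DecidableEq α]
    (φ : Letters i ↪ α) (v : ∀ k : Blocks i, VGroup k.1) :
    Perm.sign (blockPerm (blockEmb φ) v) =
      ∏ m : Fin (i 1), Perm.sign (translation (v ⟨1, m⟩)) := by
  rw [sign_blockPerm]
  symm
  apply Fintype.prod_of_injective (fun m : Fin (i 1) => (⟨1, m⟩ : Blocks i))
  · exact sigma_mk_injective (β := fun j : ℕ+ => Fin (i j))
  · rintro ⟨j, m⟩ hm
    have hj : j ≠ 1 := by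
      rintro rfl
      exact hm ⟨m, rfl⟩
    apply sign_translation
    have h1 : (j : ℕ) ≠ 1 := fun h => hj (PNat.coe_eq_one_iff.1 h)
    have := j.pos
    change 2 ≤ (j : ℕ)
    omega
  · intro m
    rfl

theorem mem_powV {j k : ℕ} {x : Perm (Σ _ : Fin k, VGroup j)} :
    x ∈ powV j k ↔
      ∃ v : Fin k → VGroup j, Perm.sigmaCongrRight (fun m => translation (v m)) = x := by
  constructor
  · rintro ⟨s, hs, rfl⟩
    have : ∀ m, ∃ v : VGroup j, translation v = s m := fun m => hs m (Set.mem_univ _)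
    choose v hv using this
    exact ⟨v, by simp only [hv]; rfl⟩
  · rintro ⟨v, rfl⟩
    exact ⟨fun m => translation (v m), fun m _ => ⟨v m, rfl⟩, rfl⟩

theorem mem_factorV {j k : ℕ} {x : Perm (Σ _ : Fin k, VGroup j)} :
    x ∈ factorV j k ↔
      ∃ v : Fin k → VGroup j, Perm.sigmaCongrRight (fun m => translation (v m)) = x ∧
        (j = 1 → ∏ m, Perm.sign (translation (v m)) = 1) := by
  unfold factorV
  split_ifs with hj
  · rw [Subgroup.mem_inf, mem_powV, Perm.mem_alternatingGroup]
    constructor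
    · rintro ⟨⟨v, rfl⟩, hs⟩
      rw [sign_sigmaCongrRight] at hs
      exact ⟨v, rfl, fun _ => hs⟩
    · rintro ⟨v, rfl, hs⟩
      refine ⟨⟨v, rfl⟩, ?_⟩
      rw [sign_sigmaCongrRight]
      exact hs hj
  · rw [mem_powV]
    simp [hj]

/-- The parity condition in the factor `E_{i_1}` is the parity of the whole permutation, since the
other factors are even. This replaces the nested products by a single homomorphism `blockPerm` and
one sign condition. -/
theorem placedGroup_eq {n : ℕ} (i : ℕ+ →₀ ℕ) (φ : Letters i ↪ Fin n) :
    placedGroup i φ = (blockPerm (blockEmb φ)).range ⊓ alternatingGroup (Fin n) := by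
  ext x
  rw [Subgroup.mem_inf, Perm.mem_alternatingGroup]
  constructor
  · rintro ⟨_, ⟨s, hs, rfl⟩, rfl⟩
    have : ∀ j : ℕ+, ∃ v : Fin (i j) → VGroup j,
        Perm.sigmaCongrRight (fun m => translation (v m)) = s j ∧
          ((j : ℕ) = 1 → ∏ m, Perm.sign (translation (v m)) = 1) :=
      fun j => mem_factorV.1 (hs j (Set.mem_univ _))
    choose v hv hv' using this
    have hx : Perm.viaEmbeddingHom φ (Perm.sigmaCongrRightHom _ s) =
        blockPerm (blockEmb φ) (fun k => v k.1 k.2) := by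
      apply eq_blockPerm
      · rintro ⟨j, m⟩ p
        rw [blockEmb_apply, Perm.viaEmbeddingHom_apply, Perm.viaEmbedding_apply]
        simp [← hv, blockEmb_apply]
      · intro y hy
        rw [range_blockEmb] at hy
        exact Perm.viaEmbedding_apply_of_notMem _ _ _ hy
    refine ⟨⟨_, hx.symm⟩, ?_⟩
    change Perm.sign (Perm.viaEmbeddingHom φ (Perm.sigmaCongrRightHom _ s)) = 1
    rw [hx, sign_blockPerm_blockEmb]
    exact hv' 1 rfl
  · rintro ⟨⟨v, rfl⟩, hs⟩
    rw [sign_blockPerm_blockEmb] at hs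
    refine ⟨_, ⟨fun j : ℕ+ =>
      Perm.sigmaCongrRight fun m : Fin (i j) => translation (v ⟨j, m⟩), ?_, rfl⟩, ?_⟩
    · intro j _
      refine mem_factorV.2 ⟨fun m => v ⟨j, m⟩, rfl, fun hj => ?_⟩
      obtain rfl : j = 1 := PNat.coe_eq_one_iff.1 hj
      exact hs
    · apply eq_blockPerm
      · rintro ⟨j, m⟩ p
        exact Perm.viaEmbedding_apply _ _ _
      · intro y hy
        rw [range_blockEmb] at hy
        exact Perm.viaEmbedding_apply_of_notMem _ _ _ hy

theorem placedGroup_conj {n : ℕ} (i : ℕ+ →₀ ℕ) (φ : Letters i ↪ Fin n) (g : Perm (Fin n)) :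
    (placedGroup i φ).map (MulAut.conj g).toMonoidHom =
      placedGroup i (φ.trans g.toEmbedding) := by
  rw [placedGroup_eq, placedGroup_eq, blockEmb_trans]
  ext x
  rw [Subgroup.mem_map, Subgroup.mem_inf]
  constructor
  · rintro ⟨_, ⟨⟨v, rfl⟩, hs⟩, rfl⟩
    exact ⟨⟨v, (blockPerm_conj _ g v).symm⟩, (alternatingGroup.normal).conj_mem _ hs g⟩
  · rintro ⟨⟨v, rfl⟩, hs⟩
    rw [← blockPerm_conj] at hs ⊢
    refine ⟨blockPerm (blockEmb φ) v, ⟨⟨v, rfl⟩, ?_⟩, rfl⟩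
    change _ ∈ alternatingGroup _
    rw [Perm.mem_alternatingGroup] at hs ⊢
    rwa [map_mul, map_mul, map_inv, mul_inv_cancel_comm] at hs

theorem exists_perm_comp_eq {n : ℕ} {L : Type*} (φ φ' : L ↪ Fin n) :
    ∃ g : Perm (Fin n), φ.trans g.toEmbedding = φ' := by
  classical
  let e : Set.range φ ≃ Set.range φ' :=
    (Equiv.ofInjective φ φ.injective).symm.trans (Equiv.ofInjective φ' φ'.injective)
  refine ⟨e.extendSubtype, ?_⟩
  ext1 a
  have := e.extendSubtype_apply_of_mem (φ a) ⟨a, rfl⟩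
  simp only [Function.Embedding.trans_apply, Equiv.coe_toEmbedding]
  rw [this]
  simp [e]

theorem HasForm.conjugateIn_top {n : ℕ} {i : ℕ+ →₀ ℕ} {A B : Subgroup (Perm (Fin n))}
    (hA : HasForm i A) (hB : HasForm i B) : ConjugateIn ⊤ A B := by
  obtain ⟨φ, rfl⟩ := hA
  obtain ⟨φ', rfl⟩ := hB
  obtain ⟨g, rfl⟩ := exists_perm_comp_eq φ φ'
  exact ⟨g, Subgroup.mem_top _, placedGroup_conj i φ g⟩

/-! ### Orbits of placed groups and uniqueness of the form -/

/-- If no block is of size two, or at least two are, then the group acts transitively on each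
block. -/
theorem exists_mem_placedGroup_apply_eq {n : ℕ} {i : ℕ+ →₀ ℕ} (hi : i 1 ≠ 1)
    (φ : Letters i ↪ Fin n) (k : Blocks i) (u : VGroup k.1) :
    ∃ v, blockPerm (blockEmb φ) v ∈ placedGroup i φ ∧ v k = u := by
  classical
  obtain ⟨j, m⟩ := k
  by_cases hj : j = 1
  · subst hj
    obtain ⟨m', hm'⟩ : ∃ m' : Fin (i 1), m' ≠ m := by
      have : Nontrivial (Fin (i 1)) := by
        rw [Fin.nontrivial_iff_two_le]
        have := m.pos
        omega
      exact exists_ne m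
    have hne : (⟨1, m⟩ : Blocks i) ≠ ⟨1, m'⟩ := by
      intro h
      exact hm' (sigma_mk_injective h).symm
    -- The same translation on a second block of size two compensates the sign.
    refine ⟨Pi.mulSingle ⟨1, m⟩ u * Pi.mulSingle ⟨1, m'⟩ u, ?_, ?_⟩
    · rw [placedGroup_eq, Subgroup.mem_inf, Perm.mem_alternatingGroup, map_mul, map_mul,
        sign_blockPerm_mulSingle (blockEmb φ) ⟨1, m⟩ u,
        sign_blockPerm_mulSingle (blockEmb φ) ⟨1, m'⟩ u]
      exact ⟨⟨_, map_mul _ _ _⟩, Int.units_mul_self _⟩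
    · rw [Pi.mul_apply, Pi.mulSingle_eq_same, Pi.mulSingle_eq_of_ne hne, mul_one]
  · refine ⟨Pi.mulSingle ⟨j, m⟩ u, ?_, by simp⟩
    rw [placedGroup_eq, Subgroup.mem_inf, Perm.mem_alternatingGroup]
    refine ⟨⟨_, rfl⟩, ?_⟩
    rw [sign_blockPerm_mulSingle]
    apply sign_translation
    have h1 : (j : ℕ) ≠ 1 := fun h => hj (PNat.coe_eq_one_iff.1 h)
    have := j.pos
    change 2 ≤ (j : ℕ)
    omega

theorem orbit_placedGroup {n : ℕ} {i : ℕ+ →₀ ℕ} (hi : i 1 ≠ 1) (φ : Letters i ↪ Fin n)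
    (k : Blocks i) (p : VGroup k.1) :
    MulAction.orbit (placedGroup i φ) (blockEmb φ ⟨k, p⟩) =
      Set.range fun q : VGroup k.1 => blockEmb φ ⟨k, q⟩ := by
  ext y
  constructor
  · rintro ⟨⟨a, ha⟩, rfl⟩
    rw [placedGroup_eq] at ha
    obtain ⟨⟨v, rfl⟩, -⟩ := ha
    exact ⟨v k * p, (blockPerm_apply _ _ _ _).symm⟩
  · rintro ⟨q, rfl⟩
    obtain ⟨v, hv, hvk⟩ := exists_mem_placedGroup_apply_eq hi φ k (q * p⁻¹)
    refine ⟨⟨_, hv⟩, ?_⟩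
    change blockPerm (blockEmb φ) v (blockEmb φ ⟨k, p⟩) = _
    rw [blockPerm_apply, hvk, inv_mul_cancel_right]

theorem orbit_placedGroup_of_notMem {n : ℕ} {i : ℕ+ →₀ ℕ} (φ : Letters i ↪ Fin n) {y : Fin n}
    (hy : y ∉ Set.range φ) : MulAction.orbit (placedGroup i φ) y = {y} := by
  ext z
  constructor
  · rintro ⟨⟨a, ha⟩, rfl⟩
    rw [placedGroup_eq] at ha
    obtain ⟨⟨v, rfl⟩, -⟩ := ha
    exact blockPerm_apply_of_notMem _ _ (by rwa [range_blockEmb])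
  · rintro rfl
    exact MulAction.mem_orbit_self _

theorem movedLetters_placedGroup {n : ℕ} {i : ℕ+ →₀ ℕ} (hi : i 1 ≠ 1) (φ : Letters i ↪ Fin n) :
    movedLetters (placedGroup i φ) = Set.range φ := by
  ext y
  constructor
  · rintro ⟨a, ha, hay⟩
    by_contra hy
    have : a y ∈ MulAction.orbit (placedGroup i φ) y := ⟨⟨a, ha⟩, rfl⟩
    rw [orbit_placedGroup_of_notMem φ hy] at this
    exact hay this
  · rintro ⟨⟨j, m, p⟩, rfl⟩
    obtain ⟨u, hu⟩ : ∃ u : VGroup j, u ≠ 1 := by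
      refine ⟨Multiplicative.ofAdd fun _ => 1, fun h => ?_⟩
      have := congr_fun (congr_arg Multiplicative.toAdd h) ⟨0, j.pos⟩
      simp at this
    obtain ⟨v, hv, hvk⟩ := exists_mem_placedGroup_apply_eq hi φ ⟨j, m⟩ u
    refine ⟨_, hv, fun h => hu ?_⟩
    have h2 := blockPerm_apply (blockEmb φ) v ⟨j, m⟩ p
    rw [hvk] at h2
    have h3 : (⟨⟨j, m⟩, u * p⟩ : Σ k : Blocks i, VGroup k.1) = ⟨⟨j, m⟩, p⟩ :=
      (blockEmb φ).injective (h2.symm.trans h)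
    simpa using h3

theorem ncard_movedLetters {n : ℕ} {i : ℕ+ →₀ ℕ} (hi : i 1 ≠ 1) (φ : Letters i ↪ Fin n) :
    (movedLetters (placedGroup i φ)).ncard = letterCount i := by
  rw [movedLetters_placedGroup hi, ← card_letters, ← Set.image_univ,
    Set.ncard_image_of_injective _ φ.injective, Set.ncard_univ, Nat.card_eq_fintype_card]

theorem letterCount_le {n : ℕ} {i : ℕ+ →₀ ℕ} (φ : Letters i ↪ Fin n) : letterCount i ≤ n := by
  rw [← card_letters]
  simpa using Fintype.card_le_of_embedding φ

/-- The blocks are the nontrivial orbits, so the multiplicities can be read off from the group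
alone. Fixed letters have orbits of size `2 ^ 0` and are not counted, as `j` is positive. -/
theorem ncard_orbit_eq {n : ℕ} {i : ℕ+ →₀ ℕ} (hi : i 1 ≠ 1) (φ : Letters i ↪ Fin n) (j : ℕ+) :
    {y : Fin n | (MulAction.orbit (placedGroup i φ) y).ncard = 2 ^ (j : ℕ)}.ncard =
      i j * 2 ^ (j : ℕ) := by
  have h1 : ∀ (k : Blocks i) (p : VGroup k.1),
      (MulAction.orbit (placedGroup i φ) (blockEmb φ ⟨k, p⟩)).ncard = 2 ^ (k.1 : ℕ) := by
    intro k p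
    rw [orbit_placedGroup hi, ← Set.image_univ, Set.ncard_image_of_injective, Set.ncard_univ]
    · simp
    · exact (blockEmb φ).injective.comp sigma_mk_injective
  have h2 : {y : Fin n | (MulAction.orbit (placedGroup i φ) y).ncard = 2 ^ (j : ℕ)} =
      (fun x : Fin (i j) × VGroup j => φ ⟨j, x.1, x.2⟩) '' Set.univ := by
    ext y
    simp only [Set.image_univ, Set.mem_ofPred_eq]
    constructor
    · intro hy
      by_cases hr : y ∈ Set.range φ
      · obtain ⟨⟨j', m, p⟩, rfl⟩ := hr
        have := (h1 ⟨j', m⟩ p).symm.trans hy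
        obtain rfl : j' = j := PNat.coe_injective (Nat.pow_right_injective le_rfl this)
        exact ⟨(m, p), rfl⟩
      · rw [orbit_placedGroup_of_notMem φ hr, Set.ncard_singleton] at hy
        have := Nat.one_lt_two_pow j.pos.ne'
        omega
    · rintro ⟨⟨m, p⟩, rfl⟩
      exact h1 ⟨j, m⟩ p
  rw [h2, Set.ncard_image_of_injective, Set.ncard_univ]
  · simp
  · rintro ⟨m, p⟩ ⟨m', p'⟩ h
    have := φ.injective h
    simpa using this

theorem form_unique {n : ℕ} {i k : ℕ+ →₀ ℕ} (hi : i 1 ≠ 1) (hk : k 1 ≠ 1) (φ : Letters i ↪ Fin n)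
    (φ' : Letters k ↪ Fin n) (h : placedGroup i φ = placedGroup k φ') : i = k := by
  ext j
  have h1 := ncard_orbit_eq hi φ j
  have h2 := ncard_orbit_eq hk φ' j
  rw [h, h2] at h1
  exact (Nat.eq_of_mul_eq_mul_right (by positivity) h1).symm

/-! ### Elementary abelian 2-groups acting on their orbits -/

theorem exists_mulEquiv_vGroup {Q : Type*} [CommGroup Q] [Finite Q] (h : ∀ q : Q, q ^ 2 = 1) :
    ∃ j, Nonempty (VGroup j ≃* Q) := by
  let _ : Module (ZMod 2) (Additive Q) := AddCommGroup.zmodModule (n := 2) fun q => h q.toMul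
  have : Module.Finite (ZMod 2) (Additive Q) := Module.Finite.of_finite
  let e := (Module.finBasis (ZMod 2) (Additive Q)).equivFun
  exact ⟨_, ⟨(AddEquiv.toMultiplicative e.symm.toAddEquiv).trans
    (MulEquiv.refl Q : Multiplicative (Additive Q) ≃* Q)⟩⟩

/-- Each orbit of an elementary abelian `2`-group of permutations is a copy of `VGroup j`, on
which the group acts by translations. -/
theorem exists_orbit_parametrization {α : Type*} [Finite α] {A : Subgroup (Perm α)}
    (hA : IsElementaryAbelianTwo A) (x : α) :
    ∃ (j : ℕ) (f : VGroup j ↪ α), Set.range f = MulAction.orbit A x ∧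
      ∀ a ∈ A, ∃ v, ∀ p, a (f p) = f (v * p) := by
  let _ : CommGroup A :=
    { (inferInstance : Group A) with
      mul_comm := fun a b => Subtype.ext (hA.1 _ a.2 _ b.2) }
  -- Since `A` is commutative, the quotient by the stabilizer is a group; it is elementary abelian
  -- and acts regularly on the orbit.
  obtain ⟨j, ⟨e⟩⟩ := exists_mulEquiv_vGroup (Q := A ⧸ MulAction.stabilizer A x) (by
    intro q
    induction q using QuotientGroup.induction_on with
    | H a =>
      rw [← QuotientGroup.mk_pow]
      have : a ^ 2 = 1 := Subtype.ext (hA.2 _ a.2)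
      rw [this]
      rfl)
  refine ⟨j, ⟨fun p => MulAction.ofQuotientStabilizer A x (e p),
    (MulAction.injective_ofQuotientStabilizer A x).comp e.injective⟩, ?_, ?_⟩
  · ext y
    constructor
    · rintro ⟨p, rfl⟩
      exact MulAction.ofQuotientStabilizer_mem_orbit A x (e p)
    · rintro ⟨a, rfl⟩
      exact ⟨e.symm a, by simp⟩
  · intro a ha
    refine ⟨e.symm ((⟨a, ha⟩ : A) : A ⧸ MulAction.stabilizer A x), fun p => ?_⟩
    simp only [Function.Embedding.coeFn_mk, map_mul, MulEquiv.apply_symm_apply]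
    exact (MulAction.ofQuotientStabilizer_smul A x ⟨a, ha⟩ (e p)).symm

/-- The blocks are the orbits of positive rank, sorted by rank; orbits of rank `0` are fixed letters
and stay outside the placement. -/
theorem exists_placement {n : ℕ} {A : Subgroup (Perm (Fin n))} (hA : IsElementaryAbelianTwo A) :
    ∃ (i : ℕ+ →₀ ℕ) (φ : Letters i ↪ Fin n), A ≤ (blockPerm (blockEmb φ)).range ∧
      ∀ k : Blocks i, ∀ p q, ∃ a ∈ A, a (blockEmb φ ⟨k, p⟩) = blockEmb φ ⟨k, q⟩ := by
  classical
  let Ω := MulAction.orbitRel.Quotient A (Fin n)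
  have hΩ : ∀ ω : Ω, ∃ (j : ℕ) (f : VGroup j ↪ Fin n), Set.range f = ω.orbit ∧
      ∀ a ∈ A, ∃ v, ∀ p, a (f p) = f (v * p) := by
    intro ω
    induction ω using Quotient.inductionOn with
    | h x => exact exists_orbit_parametrization hA x
  choose D f hf using hΩ
  -- Indexing by the rank `j` and the orbits of that rank gives all parametrizations the literal
  -- domain `VGroup j`, which avoids transport along `D ω = j`.
  have hF : ∀ (j : ℕ) (ω : {ω : Ω // D ω = j}), ∃ f : VGroup j ↪ Fin n,
      Set.range f = ω.1.orbit ∧ ∀ a ∈ A, ∃ v, ∀ p, a (f p) = f (v * p) := by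
    rintro _ ⟨ω, rfl⟩
    exact ⟨f ω, hf ω⟩
  choose F hFr hFa using hF
  let i : ℕ+ →₀ ℕ := Finsupp.ofSupportFinite (fun j => Nat.card {ω : Ω // D ω = j}) (by
    refine Set.Finite.subset ((Set.finite_range D).preimage PNat.coe_injective.injOn) ?_
    intro j hj
    have : Nat.card {ω : Ω // D ω = j} ≠ 0 := hj
    obtain ⟨⟨ω, hω⟩⟩ := (Nat.card_ne_zero.1 this).1
    exact ⟨ω, hω⟩)
  let e : ∀ j : ℕ+, Fin (i j) ≃ {ω : Ω // D ω = j} := fun j => (Finite.equivFin _).symm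
  have hmem : ∀ (j : ℕ+) (m : Fin (i j)) (p : VGroup j), F j (e j m) p ∈ (e j m).1.orbit := by
    intro j m p
    rw [← hFr]
    exact ⟨p, rfl⟩
  let φ : Letters i ↪ Fin n := ⟨fun l => F l.1 (e l.1 l.2.1) l.2.2, by
    rintro ⟨j, m, p⟩ ⟨j', m', p'⟩ h
    have h1 := hmem j m p
    have h2 := hmem j' m' p'
    rw [MulAction.orbitRel.Quotient.mem_orbit] at h1 h2
    have h' : F j (e j m) p = F j' (e j' m') p' := h
    rw [h', h2] at h1
    obtain rfl : j = j' := PNat.coe_injective (by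
      rw [← (e j m).2, ← (e j' m').2, h1])
    obtain rfl : m = m' := (e j).injective (Subtype.ext h1.symm)
    rw [(F j (e j m)).injective h']⟩
  refine ⟨i, φ, ?_, ?_⟩
  · intro a ha
    choose v hv using fun k : Blocks i => hFa k.1 (e k.1 k.2) a ha
    refine ⟨v, (eq_blockPerm _ _ _ hv ?_).symm⟩
    intro y hy
    rw [range_blockEmb] at hy
    let ω : Ω := Quotient.mk _ y
    have hyω : y ∈ ω.orbit := by
      rw [MulAction.orbitRel.Quotient.mem_orbit]
    -- Every orbit of positive rank is one of the placed blocks, so the orbit of `y` has rank `0`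
    -- and is a single point.
    have hD : D ω = 0 := by
      by_contra hD
      let j : ℕ+ := ⟨D ω, Nat.pos_of_ne_zero hD⟩
      obtain ⟨m, hm⟩ := (e j).surjective ⟨ω, rfl⟩
      have : y ∈ Set.range (F j (e j m)) := by
        rw [hFr, hm]
        exact hyω
      obtain ⟨p, hp⟩ := this
      exact hy ⟨⟨j, m, p⟩, hp⟩
    have hya : a y ∈ ω.orbit := by
      rw [MulAction.orbitRel.Quotient.mem_orbit]
      exact Quotient.sound ⟨⟨a, ha⟩, rfl⟩
    have hr := hFr 0 ⟨ω, hD⟩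
    rw [← hr] at hya hyω
    obtain ⟨p, hp⟩ := hya
    obtain ⟨q, hq⟩ := hyω
    rw [← hp, ← hq, Subsingleton.elim p q]
  · rintro ⟨j, m⟩ p q
    have h1 := hmem j m p
    have h2 := hmem j m q
    rw [MulAction.orbitRel.Quotient.mem_orbit] at h1 h2
    obtain ⟨a, ha⟩ := Quotient.exact (h2.trans h1.symm)
    exact ⟨a.1, a.2, ha⟩

/-! ### Consequences of maximality -/

/-- The union of `A` and `t A` is again an elementary abelian 2-subgroup of `H`. -/
theorem mem_of_isMaxElementaryAbelianTwo {G : Type*} [Group G] {H A : Subgroup G}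
    (hA : IsMaxElementaryAbelianTwo H A) {t : G} (htH : t ∈ H) (ht : t ^ 2 = 1)
    (hc : ∀ a ∈ A, t * a = a * t) : t ∈ A := by
  obtain ⟨⟨hAH, hAc, hAs⟩, hmax⟩ := hA
  have htt : t * t = 1 := by rwa [sq] at ht
  have htinv : t⁻¹ = t := inv_eq_of_mul_eq_one_left htt
  have key : ∀ a ∈ A, ∀ b, t * a * (t * b) = a * b := fun a ha b => by
    rw [hc a ha, mul_assoc, ← mul_assoc t t, htt, one_mul]
  let F : Subgroup G :=
    { carrier := {x | x ∈ A ∨ ∃ a ∈ A, x = t * a}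
      one_mem' := Or.inl A.one_mem
      mul_mem' := by
        rintro x y (hx | ⟨a, ha, rfl⟩) (hy | ⟨b, hb, rfl⟩)
        · exact Or.inl (A.mul_mem hx hy)
        · exact Or.inr ⟨x * b, A.mul_mem hx hb, by rw [← mul_assoc, ← hc x hx, mul_assoc]⟩
        · exact Or.inr ⟨a * y, A.mul_mem ha hy, by rw [mul_assoc]⟩
        · refine Or.inl ?_
          rw [key a ha]
          exact A.mul_mem ha hb
      inv_mem' := by
        rintro x (hx | ⟨a, ha, rfl⟩)
        · exact Or.inl (A.inv_mem hx)
        · exact Or.inr ⟨a⁻¹, A.inv_mem ha, by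
            rw [mul_inv_rev, htinv, hc _ (A.inv_mem ha)]⟩ }
  have hF : F ≤ A := by
    refine hmax ⟨?_, ?_, ?_⟩ fun a ha => Or.inl ha
    · rintro x (hx | ⟨a, ha, rfl⟩)
      · exact hAH hx
      · exact H.mul_mem htH (hAH ha)
    · rintro x (hx | ⟨a, ha, rfl⟩) y (hy | ⟨b, hb, rfl⟩)
      · exact hAc x hx y hy
      · rw [mul_assoc, ← hAc x hx b hb, ← mul_assoc, ← hc x hx, mul_assoc]
      · rw [mul_assoc, hAc a ha y hy, ← mul_assoc, hc y hy, mul_assoc]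
      · rw [key a ha, key b hb, hAc a ha b hb]
    · rintro x (hx | ⟨a, ha, rfl⟩)
      · exact hAs x hx
      · rw [sq, key a ha, ← sq, hAs a ha]
  exact hF (Or.inr ⟨1, A.one_mem, by simp⟩)

theorem placedGroup_apply_of_notMem {n : ℕ} {i : ℕ+ →₀ ℕ} {φ : Letters i ↪ Fin n} {y : Fin n}
    (hy : y ∉ Set.range φ) {a : Perm (Fin n)} (ha : a ∈ placedGroup i φ) : a y = y := by
  rw [placedGroup_eq] at ha
  obtain ⟨⟨v, rfl⟩, -⟩ := ha
  exact blockPerm_apply_of_notMem _ _ (by rwa [range_blockEmb])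

theorem card_compl_range {n : ℕ} {i : ℕ+ →₀ ℕ} (φ : Letters i ↪ Fin n) :
    (Finset.univ.map φ)ᶜ.card = n - letterCount i := by
  rw [Finset.card_compl, Finset.card_map, Finset.card_univ, card_letters, Fintype.card_fin]

theorem isElementaryAbelianTwo_placedGroup {n : ℕ} (i : ℕ+ →₀ ℕ) (φ : Letters i ↪ Fin n) :
    IsElementaryAbelianTwo (placedGroup i φ) :=
  isElementaryAbelianTwo_of_le_range (blockEmb φ) (by
    rw [placedGroup_eq]
    exact inf_le_left)

theorem placedGroup_le_alternatingGroup {n : ℕ} (i : ℕ+ →₀ ℕ) (φ : Letters i ↪ Fin n) :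
    placedGroup i φ ≤ alternatingGroup (Fin n) := by
  rw [placedGroup_eq]
  exact inf_le_right

theorem swap_mul_eq_mul_swap_of_fixed {α : Type*} [DecidableEq α] {x y : α} {a : Perm α}
    (hx : a x = x) (hy : a y = y) : swap x y * a = a * swap x y := by
  rw [mul_swap_eq_swap_mul, hx, hy]

/-- The product of two disjoint transpositions of four fixed letters is an even involution
centralizing the group, so it would belong to the group while moving a letter that the group fixes.
-/
theorem le_letterCount_add_three {n : ℕ} {i : ℕ+ →₀ ℕ} {φ : Letters i ↪ Fin n}
    (h : IsMaxElementaryAbelianTwo (alternatingGroup (Fin n)) (placedGroup i φ)) :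
    n ≤ letterCount i + 3 := by
  by_contra! hn
  have hcard : 4 ≤ (Finset.univ.map φ)ᶜ.card := by
    rw [card_compl_range]
    omega
  obtain ⟨s, hs, hs4⟩ := Finset.exists_subset_card_eq hcard
  obtain ⟨g⟩ : Nonempty (Fin 4 ↪ s) := by
    rw [Function.Embedding.nonempty_iff_card_le]
    simp [hs4]
  have hout : ∀ t, (g t : Fin n) ∉ Set.range φ := by
    intro t ht
    have := hs (g t).2
    simp only [Finset.mem_compl, Finset.mem_map, Finset.mem_univ, true_and] at this
    exact this ht
  have hne : ∀ t u, t ≠ u → (g t : Fin n) ≠ g u := fun t u htu h =>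
    htu (g.injective (Subtype.ext h))
  have hdisj : (swap (g 0 : Fin n) (g 1)).Disjoint (swap (g 2 : Fin n) (g 3)) := by
    rw [Perm.disjoint_iff_disjoint_support, Perm.support_swap (hne 0 1 (by decide)),
      Perm.support_swap (hne 2 3 (by decide))]
    simp [hne]
  have hmem := mem_of_isMaxElementaryAbelianTwo h
    (t := swap (g 0 : Fin n) (g 1) * swap (g 2 : Fin n) (g 3))
    (by
      rw [Perm.mem_alternatingGroup, map_mul, Perm.sign_swap (hne 0 1 (by decide)),
        Perm.sign_swap (hne 2 3 (by decide))]
      rfl)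
    (by
      rw [hdisj.commute.mul_pow, sq, sq, swap_mul_self, swap_mul_self, one_mul])
    (fun a ha => by
      rw [mul_assoc, swap_mul_eq_mul_swap_of_fixed (placedGroup_apply_of_notMem (hout 2) ha)
        (placedGroup_apply_of_notMem (hout 3) ha), ← mul_assoc,
        swap_mul_eq_mul_swap_of_fixed (placedGroup_apply_of_notMem (hout 0) ha)
        (placedGroup_apply_of_notMem (hout 1) ha), mul_assoc])
  have h1 := placedGroup_apply_of_notMem (hout 0) hmem
  rw [Perm.mul_apply, swap_apply_of_ne_of_ne (hne 0 2 (by decide)) (hne 0 3 (by decide)),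
    swap_apply_left] at h1
  exact hne 1 0 (by decide) h1

theorem exists_form_of_isMax {n : ℕ} {A : Subgroup (Perm (Fin n))}
    (hA : IsMaxElementaryAbelianTwo (alternatingGroup (Fin n)) A) :
    ∃ (i : ℕ+ →₀ ℕ) (φ : Letters i ↪ Fin n), i 1 ≠ 1 ∧ A = placedGroup i φ := by
  obtain ⟨i, φ, hle, htrans⟩ := exists_placement hA.prop.2
  have hle' : A ≤ placedGroup i φ := by
    rw [placedGroup_eq]
    exact le_inf hle hA.prop.1
  have heq : A = placedGroup i φ := le_antisymm hle' (hA.le_of_ge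
    ⟨placedGroup_le_alternatingGroup i φ, isElementaryAbelianTwo_placedGroup i φ⟩ hle')
  refine ⟨i, φ, fun hi => ?_, heq⟩
  have m : Fin (i 1) := ⟨0, by omega⟩
  have hsub : ∀ m' : Fin (i 1), m' = m := by
    intro m'
    ext
    omega
  let u : VGroup 1 := Multiplicative.ofAdd 1
  have hu : u ≠ 1 := by decide
  let k : Blocks i := ⟨1, m⟩
  -- Transitivity on the only block of size two yields an element of `A` swapping its letters; all
  -- other blocks contribute sign `1`, so that element is odd.
  obtain ⟨a, ha, hau⟩ := htrans k 1 u
  obtain ⟨v, rfl⟩ := hle ha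
  have hs := hA.prop.1 ha
  rw [Perm.mem_alternatingGroup, sign_blockPerm_blockEmb, Finset.prod_eq_single m
    (fun m' _ h => absurd (hsub m') h) (by simp)] at hs
  have hv : v k * 1 = u := sigma_mk_injective (β := fun k : Blocks i => VGroup k.1)
    ((blockEmb φ).injective ((blockPerm_apply _ _ _ _).symm.trans hau))
  replace hv : v ⟨1, m⟩ = u := (mul_one _).symm.trans hv
  rw [hv] at hs
  exact absurd ((sign_translation_one hu).symm.trans hs) (by decide)

/-! ### Centralizer and normalizer of the block translations -/

theorem VGroup.exists_ne_one {j : ℕ} (hj : j ≠ 0) : ∃ v : VGroup j, v ≠ 1 := by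
  refine ⟨Multiplicative.ofAdd fun _ => 1, fun h => ?_⟩
  have := congr_fun (congr_arg Multiplicative.toAdd h) ⟨0, Nat.pos_of_ne_zero hj⟩
  simp at this

section
variable {K α : Type*} {d : K → ℕ} {ψ : (Σ k, VGroup (d k)) ↪ α}

theorem blockPerm_mulSingle_apply [DecidableEq K] (k : K) (v p : VGroup (d k)) :
    blockPerm ψ (Pi.mulSingle k v) (ψ ⟨k, p⟩) = ψ ⟨k, v * p⟩ := by
  rw [blockPerm_apply, Pi.mulSingle_eq_same]

theorem blockPerm_mulSingle_apply_of_ne [DecidableEq K] {k k' : K} (h : k' ≠ k) (v : VGroup (d k))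
    (p : VGroup (d k')) : blockPerm ψ (Pi.mulSingle k v) (ψ ⟨k', p⟩) = ψ ⟨k', p⟩ := by
  rw [blockPerm_apply, Pi.mulSingle_eq_of_ne h, one_mul]

theorem emb_mk_injective (k : K) : Function.Injective fun p : VGroup (d k) => ψ ⟨k, p⟩ :=
  ψ.injective.comp sigma_mk_injective

/-- A permutation centralizing all translations of the blocks translates each block. -/
theorem exists_translation_of_centralizes (hd : ∀ k, d k ≠ 0) {x : Perm α}
    (hx : ∀ v, x * blockPerm ψ v = blockPerm ψ v * x) :
    ∃ v : ∀ k, VGroup (d k), ∀ k p, x (ψ ⟨k, p⟩) = ψ ⟨k, v k * p⟩ := by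
  classical
  have hx' : ∀ v y, x (blockPerm ψ v y) = blockPerm ψ v (x y) := fun v y =>
    Perm.congr_fun (hx v) y
  -- The image of a letter of block `k` is moved by a translation supported on block `k`, hence lies
  -- in that block. Commuting with the translations then determines `x` on the block from this one
  -- value.
  have h1 : ∀ k, ∃ q, x (ψ ⟨k, 1⟩) = ψ ⟨k, q⟩ := by
    intro k
    obtain ⟨u, hu⟩ := VGroup.exists_ne_one (hd k)
    have hmove : blockPerm ψ (Pi.mulSingle k u) (x (ψ ⟨k, 1⟩)) ≠ x (ψ ⟨k, 1⟩) := by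
      rw [← hx', blockPerm_mulSingle_apply]
      intro h
      exact hu (by simpa using emb_mk_injective k (x.injective h))
    by_cases hr : x (ψ ⟨k, 1⟩) ∈ Set.range ψ
    · obtain ⟨⟨k', q⟩, hq⟩ := hr
      by_cases hk : k' = k
      · subst hk
        exact ⟨q, hq.symm⟩
      · rw [← hq, blockPerm_mulSingle_apply_of_ne hk] at hmove
        exact absurd rfl hmove
    · exact absurd (blockPerm_apply_of_notMem _ _ hr) hmove
  choose v hv using h1
  refine ⟨v, fun k p => ?_⟩
  have := hx' (Pi.mulSingle k p) (ψ ⟨k, 1⟩)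
  rw [hv, blockPerm_mulSingle_apply, blockPerm_mulSingle_apply, mul_one, mul_comm] at this
  exact this

/-- The canonical isomorphism between `VGroup`s of equal rank. -/
def vGroupCast {j k : ℕ} (h : j = k) : VGroup j ≃* VGroup k := h ▸ MulEquiv.refl (VGroup j)

theorem toAdd_vGroupCast_zero {j k : ℕ} (h : j = k) (hj : 0 < j) (hk : 0 < k) (p : VGroup j) :
    Multiplicative.toAdd (vGroupCast h p) ⟨0, hk⟩ = Multiplicative.toAdd p ⟨0, hj⟩ := by
  subst h
  rfl

theorem vGroupCast_ofAdd_const {j k : ℕ} (h : j = k) (c : ZMod 2) :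
    vGroupCast h (Multiplicative.ofAdd fun _ => c) = Multiplicative.ofAdd fun _ => c := by
  subst h
  rfl

/-- The flip is translation by the all-ones vector on every block at once: it commutes with the
identifications of blocks and changes the zeroth coordinate, which these preserve. -/
theorem sign_sigmaCongr_vGroupCast [Fintype K] [DecidableEq K] (hd : ∀ k, 0 < d k)
    (π : Perm K) (hπ : ∀ k, d k = d (π k)) :
    Perm.sign (Equiv.sigmaCongr π fun k => (vGroupCast (hπ k)).toEquiv) = 1 := by
  refine sign_eq_one_of_commute_flip _
    (Perm.sigmaCongrRight fun k => translation (Multiplicative.ofAdd fun _ => 1))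
    (fun x => Multiplicative.toAdd x.2 ⟨0, hd x.1⟩) ?_ ?_ ?_
  · rintro ⟨k, p⟩
    exact toAdd_vGroupCast_zero (hπ k) (hd _) (hd _) p
  · rintro ⟨k, p⟩
    exact add_comm _ _
  · rintro ⟨k, p⟩
    refine Sigma.ext rfl (heq_of_eq ?_)
    change vGroupCast (hπ k) ((Multiplicative.ofAdd fun _ => 1) * p) =
      (Multiplicative.ofAdd fun _ => 1) * vGroupCast (hπ k) p
    rw [map_mul, vGroupCast_ofAdd_const]

/-- The normalizer of the group of block translations consists of even permutations if all blocks
have at least eight points and at most one point lies outside the blocks. -/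
theorem sign_eq_one_of_normalizes [Finite K] [Fintype α] [DecidableEq α] (hd : ∀ k, 3 ≤ d k)
    (hc : ∀ y z, y ∉ Set.range ψ → z ∉ Set.range ψ → y = z) {x : Perm α}
    (hx : ∀ v, ∃ w, x * blockPerm ψ v = blockPerm ψ w * x)
    (hx' : ∀ w, ∃ v, x * blockPerm ψ v = blockPerm ψ w * x) : Perm.sign x = 1 := by
  classical
  have := Fintype.ofFinite K
  have hap : ∀ {v w}, x * blockPerm ψ v = blockPerm ψ w * x →
      ∀ y, x (blockPerm ψ v y) = blockPerm ψ w (x y) := fun h y => Perm.congr_fun h y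
  have h1 : ∀ k, ∃ l q, x (ψ ⟨k, 1⟩) = ψ ⟨l, q⟩ := by
    intro k
    by_contra! hno
    have hr : x (ψ ⟨k, 1⟩) ∉ Set.range ψ := by
      rintro ⟨⟨l, q⟩, h⟩
      exact hno l q h.symm
    obtain ⟨u, hu⟩ := VGroup.exists_ne_one (show d k ≠ 0 by have := hd k; omega)
    obtain ⟨w, hw⟩ := hx (Pi.mulSingle k u)
    have h := hap hw (ψ ⟨k, 1⟩)
    rw [blockPerm_apply_of_notMem _ _ hr, blockPerm_mulSingle_apply] at h
    exact hu (by simpa using emb_mk_injective k (x.injective h))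
  choose π c hc1 using h1
  have h2 : ∀ k p, ∃ q, x (ψ ⟨k, p⟩) = ψ ⟨π k, q⟩ := by
    intro k p
    obtain ⟨w, hw⟩ := hx (Pi.mulSingle k p)
    have h := hap hw (ψ ⟨k, 1⟩)
    rw [blockPerm_mulSingle_apply, mul_one, hc1, blockPerm_apply] at h
    exact ⟨_, h⟩
  choose f hf using h2
  have hfinj : ∀ k, Function.Injective (f k) := by
    intro k p q hpq
    have : x (ψ ⟨k, p⟩) = x (ψ ⟨k, q⟩) := by rw [hf, hf, hpq]
    exact emb_mk_injective k (x.injective this)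
  -- Here the normalizing condition is used in the other direction: a translation of the target
  -- block comes from a translation of the source, so `x` maps block `k` onto block `π k`.
  have hpre : ∀ k q, ∃ p, x (ψ ⟨k, p⟩) = ψ ⟨π k, q⟩ := by
    intro k q
    obtain ⟨v, hv⟩ := hx' (Pi.mulSingle (π k) (q * (f k 1)⁻¹))
    have h := hap hv (ψ ⟨k, 1⟩)
    rw [hf, blockPerm_mulSingle_apply, inv_mul_cancel_right, blockPerm_apply] at h
    exact ⟨_, h⟩
  have hfsurj : ∀ k, Function.Surjective (f k) := by
    intro k q
    obtain ⟨p, hp⟩ := hpre k q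
    rw [hf] at hp
    exact ⟨p, emb_mk_injective _ hp⟩
  have hπinj : Function.Injective π := by
    intro k k' hkk
    have : ∃ p, x (ψ ⟨k, p⟩) = x (ψ ⟨k', 1⟩) := by
      have : ∃ q : VGroup (d (π k)), ψ ⟨π k', f k' 1⟩ = ψ ⟨π k, q⟩ := by
        rw [hkk]
        exact ⟨_, rfl⟩
      obtain ⟨q, hq⟩ := this
      obtain ⟨p, hp⟩ := hpre k q
      exact ⟨p, by rw [hf k', hq, hp]⟩
    obtain ⟨p, hp⟩ := this
    exact congr_arg Sigma.fst (ψ.injective (x.injective hp))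
  let π' : Perm K := Equiv.ofBijective π (Finite.injective_iff_bijective.1 hπinj)
  have hdπ : ∀ k, d k = d (π' k) := by
    intro k
    have h := Fintype.card_of_bijective ⟨hfinj k, hfsurj k⟩
    simp only [Fintype.card_multiplicative, Fintype.card_pi, ZMod.card, Finset.prod_const,
      Finset.card_univ, Fintype.card_fin] at h
    exact Nat.pow_right_injective le_rfl h
  let e : ∀ k, VGroup (d k) ≃ VGroup (d (π' k)) := fun k =>
    Equiv.ofBijective (f k) ⟨hfinj k, hfsurj k⟩
  -- Identifying block `π k` with block `k` turns `x` into a permutation of a single block that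
  -- normalizes its translations.
  let h : ∀ k, Perm (VGroup (d k)) := fun k => (e k).trans (vGroupCast (hdπ k)).symm.toEquiv
  have hsign : ∀ k, Perm.sign (h k) = 1 := by
    intro k
    apply sign_of_normalizes_translations (hd k)
    intro v
    obtain ⟨w, hw⟩ := hx (Pi.mulSingle k v)
    refine ⟨(vGroupCast (hdπ k)).symm (w (π k)), fun p => ?_⟩
    have hfv : f k (v * p) = w (π k) * f k p := by
      have := hap hw (ψ ⟨k, p⟩)
      rw [blockPerm_mulSingle_apply, hf, hf, blockPerm_apply] at this
      exact emb_mk_injective _ this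
    change (vGroupCast (hdπ k)).symm (f k (v * p)) = _ * (vGroupCast (hdπ k)).symm (f k p)
    rw [hfv]
    exact map_mul (vGroupCast (hdπ k)).symm _ _
  have hx2 : x = ((Equiv.sigmaCongr π' fun k => (vGroupCast (hdπ k)).toEquiv) *
      Perm.sigmaCongrRight h : Perm (Σ k, VGroup (d k))).viaEmbedding ψ := by
    apply eq_viaEmbedding
    · rintro ⟨k, p⟩
      rw [hf]
      congr 1
      refine Sigma.ext rfl (heq_of_eq ?_)
      exact ((vGroupCast (hdπ k)).apply_symm_apply (f k p)).symm
    · intro y hy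
      -- `x` maps the complement of the blocks to itself, and this complement has at most one point.
      refine hc _ _ ?_ hy
      rintro ⟨⟨l, q⟩, hl⟩
      obtain ⟨k, rfl⟩ := π'.surjective l
      obtain ⟨p, hp⟩ := hpre k q
      exact hy ⟨_, x.injective (hp.trans hl)⟩
  rw [hx2, sign_viaEmbedding, map_mul, sign_sigmaCongrRight,
    sign_sigmaCongr_vGroupCast (fun k => by have := hd k; omega), Finset.prod_eq_one, one_mul]
  exact fun k _ => hsign k

end

/-! ### Maximality and splitting without small blocks -/

/-- A support of two letters gives a transposition, which is odd; one of three letters gives a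
3-cycle, of order three. -/
theorem eq_one_of_sq_eq_one_of_card_support_le {α : Type*} [Fintype α] [DecidableEq α]
    {y : Perm α} (hy : y ^ 2 = 1)
    (h : y.support.card ≤ 1 ∨ y.support.card ≤ 3 ∧ Perm.sign y = 1) : y = 1 := by
  rcases h with h | ⟨h, hs⟩
  · exact Perm.card_support_le_one.1 h
  · by_contra hne
    have h0 : y.support.card ≠ 0 := by
      simpa using hne
    have h1 := Perm.card_support_ne_one y
    obtain h2 | h3 : y.support.card = 2 ∨ y.support.card = 3 := by omega
    · rw [(Perm.card_support_eq_two.1 h2).sign_eq] at hs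
      exact absurd hs (by decide)
    · have := (card_support_eq_three_iff.1 h3).orderOf
      have h4 := orderOf_dvd_of_pow_eq_one hy
      rw [this] at h4
      exact absurd h4 (by decide)

theorem placedGroup_eq_range {n : ℕ} {i : ℕ+ →₀ ℕ} (hi : i 1 = 0) (φ : Letters i ↪ Fin n) :
    placedGroup i φ = (blockPerm (blockEmb φ)).range := by
  rw [placedGroup_eq, inf_eq_left]
  rintro _ ⟨v, rfl⟩
  have : IsEmpty (Fin (i 1)) := by
    rw [hi]
    infer_instance
  change _ ∈ alternatingGroup _
  rw [Perm.mem_alternatingGroup, sign_blockPerm_blockEmb, Finset.prod_of_isEmpty]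

/-- An element `x` of a larger elementary abelian group centralizes all block translations, so it
agrees with some `blockPerm` on the blocks. Their product is an element of that group supported on
the fixed letters, which are too few for a nontrivial involution of the permitted sign. -/
theorem isMax_placedGroup {n : ℕ} {i : ℕ+ →₀ ℕ} (hi : i 1 = 0) (φ : Letters i ↪ Fin n)
    {H : Subgroup (Perm (Fin n))} (hle : placedGroup i φ ≤ H)
    (hH : n ≤ letterCount i + 1 ∨ n ≤ letterCount i + 3 ∧ H ≤ alternatingGroup (Fin n)) :
    IsMaxElementaryAbelianTwo H (placedGroup i φ) := by
  refine ⟨⟨hle, isElementaryAbelianTwo_placedGroup i φ⟩, ?_⟩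
  rintro F ⟨hFH, hFc, hFs⟩ hAF x hx
  rw [placedGroup_eq_range hi] at hAF ⊢
  obtain ⟨v, hv⟩ := exists_translation_of_centralizes (ψ := blockEmb φ)
    (fun k => k.1.pos.ne') (x := x) fun v => hFc x hx _ (hAF ⟨v, rfl⟩)
  have hyF : blockPerm (blockEmb φ) v * x ∈ F := F.mul_mem (hAF ⟨v, rfl⟩) hx
  have hsupp : (blockPerm (blockEmb φ) v * x).support ⊆ (Finset.univ.map φ)ᶜ := by
    intro y hy
    rw [Finset.mem_compl]
    intro hy'
    obtain ⟨⟨j, m, p⟩, -, rfl⟩ := Finset.mem_map.1 hy'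
    rw [Perm.mem_support, Perm.mul_apply] at hy
    apply hy
    have h1 := hv ⟨j, m⟩ p
    rw [blockEmb_apply] at h1
    rw [h1, blockPerm_apply, ← mul_assoc, VGroup.mul_self, one_mul]
    rfl
  have hcard := Finset.card_le_card hsupp
  rw [card_compl_range] at hcard
  have hy1 : blockPerm (blockEmb φ) v * x = 1 := by
    apply eq_one_of_sq_eq_one_of_card_support_le (hFs _ hyF)
    rcases hH with h | ⟨h, hH⟩
    · left
      omega
    · right
      exact ⟨by omega, Perm.mem_alternatingGroup.1 (hH (hFH hyF))⟩
  refine ⟨v, ?_⟩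
  rw [← mul_right_inj (blockPerm (blockEmb φ) v), hy1, blockPerm_mul_self]

theorem map_conj_map_conj {G : Type*} [Group G] (A : Subgroup G) (g h : G) :
    (A.map (MulAut.conj h).toMonoidHom).map (MulAut.conj g).toMonoidHom =
      A.map (MulAut.conj (g * h)).toMonoidHom := by
  rw [Subgroup.map_map, map_mul]
  rfl

theorem mul_inv_mem_alternatingGroup {α : Type*} [Fintype α] [DecidableEq α] {g τ : Perm α}
    (hg : Perm.sign g ≠ 1) (hτ : Perm.sign τ = -1) : g * τ⁻¹ ∈ alternatingGroup α := by
  rw [Perm.mem_alternatingGroup, map_mul, map_inv, hτ,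
    (Int.units_eq_one_or _).resolve_left hg]
  rfl

theorem classSplitsInTwo_placedGroup {n : ℕ} {i : ℕ+ →₀ ℕ} (hi : i ≠ 0) (hi1 : i 1 = 0)
    (hi2 : i 2 = 0) (φ : Letters i ↪ Fin n) (hn : n ≤ letterCount i + 1) :
    ClassSplitsInTwo (alternatingGroup (Fin n)) (placedGroup i φ) := by
  -- An odd permutation requires two letters; `i ≠ 0` provides them.
  obtain ⟨τ, hτ⟩ : ∃ τ : Perm (Fin n), Perm.sign τ = -1 := by
    obtain ⟨j, hj⟩ := Finsupp.ne_iff.1 hi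
    obtain ⟨u, hu⟩ := VGroup.exists_ne_one j.pos.ne'
    have m : Fin (i j) := ⟨0, Nat.pos_of_ne_zero hj⟩
    refine ⟨_, Perm.sign_swap ((emb_mk_injective (ψ := blockEmb φ) ⟨j, m⟩).ne hu)⟩
  have hd : ∀ k : Blocks i, 3 ≤ (k.1 : ℕ) := by
    rintro ⟨j, m⟩
    have h0 := j.pos
    have h1 : (j : ℕ) ≠ 1 := by
      intro h
      obtain rfl : j = 1 := PNat.coe_injective h
      exact (hi1 ▸ m).elim0
    have h2 : (j : ℕ) ≠ 2 := by
      intro h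
      obtain rfl : j = 2 := PNat.coe_injective h
      exact (hi2 ▸ m).elim0
    change 3 ≤ (j : ℕ)
    omega
  have hc : ∀ y z, y ∉ Set.range (blockEmb φ) → z ∉ Set.range (blockEmb φ) → y = z := by
    intro y z hy hz
    rw [range_blockEmb] at hy hz
    have h1 : (Finset.univ.map φ)ᶜ.card ≤ 1 := by
      rw [card_compl_range]
      omega
    refine Finset.card_le_one.1 h1 y ?_ z ?_
    · simpa using hy
    · simpa using hz
  refine ⟨placedGroup i φ, (placedGroup i φ).map (MulAut.conj τ).toMonoidHom,
    ⟨1, Subgroup.mem_top _, ?_⟩, ⟨τ, Subgroup.mem_top _, rfl⟩, ?_, ?_⟩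
  · rw [map_one]
    exact Subgroup.map_id _
  · rintro ⟨g, hg, h⟩
    rw [placedGroup_eq_range hi1] at h
    -- If an even `g` and the odd `τ` have the same effect on the group, then `τ⁻¹ * g` is an odd
    -- element of its normalizer.
    have hsg : Perm.sign (τ⁻¹ * g) = 1 := by
      refine sign_eq_one_of_normalizes (ψ := blockEmb φ) hd hc ?_ ?_
      · intro v
        have : g * blockPerm (blockEmb φ) v * g⁻¹ ∈
            (blockPerm (blockEmb φ)).range.map (MulAut.conj τ).toMonoidHom := by
          rw [← h]
          exact ⟨_, ⟨v, rfl⟩, rfl⟩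
        obtain ⟨_, ⟨w, rfl⟩, hw⟩ := this
        have hw' : τ * blockPerm (blockEmb φ) w * τ⁻¹ = g * blockPerm (blockEmb φ) v * g⁻¹ := hw
        refine ⟨w, ?_⟩
        rw [mul_assoc, inv_mul_eq_iff_eq_mul, mul_inv_eq_iff_eq_mul.1 hw'.symm]
        group
      · intro w
        have : τ * blockPerm (blockEmb φ) w * τ⁻¹ ∈
            (blockPerm (blockEmb φ)).range.map (MulAut.conj g).toMonoidHom := by
          rw [h]
          exact ⟨_, ⟨w, rfl⟩, rfl⟩
        obtain ⟨_, ⟨v, rfl⟩, hv⟩ := this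
        have hw' : g * blockPerm (blockEmb φ) v * g⁻¹ = τ * blockPerm (blockEmb φ) w * τ⁻¹ := hv
        refine ⟨v, ?_⟩
        rw [mul_assoc, inv_mul_eq_iff_eq_mul, mul_inv_eq_iff_eq_mul.1 hw']
        group
    rw [map_mul, map_inv, hτ, Perm.mem_alternatingGroup.1 hg] at hsg
    exact absurd hsg (by decide)
  · rintro D ⟨g, -, rfl⟩
    by_cases hg : Perm.sign g = 1
    · exact Or.inl ⟨g, Perm.mem_alternatingGroup.2 hg, rfl⟩
    · refine Or.inr ⟨g * τ⁻¹, mul_inv_mem_alternatingGroup hg hτ, ?_⟩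
      rw [map_conj_map_conj, inv_mul_cancel_right]

/-! ### Odd normalizing elements and conjugacy in the alternating group -/

theorem map_conj_eq_of_forall_mem {G : Type*} [Group G] [Finite G] {A : Subgroup G} {g : G}
    (h : ∀ a ∈ A, g * a * g⁻¹ ∈ A) : A.map (MulAut.conj g).toMonoidHom = A := by
  refine Subgroup.eq_of_le_of_card_ge ?_ (le_of_eq ?_)
  · rintro _ ⟨a, ha, rfl⟩
    exact h a ha
  · exact (Nat.card_congr
      (A.equivMapOfInjective _ (MulAut.conj g).injective).toEquiv)

/-- An odd conjugating element becomes even after composition with `τ⁻¹`, which leaves `A` in place.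
-/
theorem conjugateIn_alternatingGroup_of_odd_normalizes {α : Type*} [Fintype α] [DecidableEq α]
    {A B : Subgroup (Perm α)} (hAB : ConjugateIn ⊤ A B) {τ : Perm α} (hτ : Perm.sign τ = -1)
    (h : ∀ a ∈ A, τ * a * τ⁻¹ ∈ A) : ConjugateIn (alternatingGroup α) A B := by
  obtain ⟨g, -, rfl⟩ := hAB
  by_cases hg : Perm.sign g = 1
  · exact ⟨g, Perm.mem_alternatingGroup.2 hg, rfl⟩
  · refine ⟨g * τ⁻¹, mul_inv_mem_alternatingGroup hg hτ, ?_⟩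
    conv_lhs => rw [← map_conj_eq_of_forall_mem h]
    rw [map_conj_map_conj, inv_mul_cancel_right]

theorem exists_odd_normalizing_translations {d : ℕ} (hd : d = 1 ∨ d = 2) :
    ∃ σ : Perm (VGroup d), Perm.sign σ = -1 ∧ ∀ v, ∃ w, ∀ p, σ (v * p) = w * σ p := by
  rcases hd with rfl | rfl
  · obtain ⟨u, hu⟩ := VGroup.exists_ne_one (one_ne_zero (α := ℕ))
    exact ⟨translation u, sign_translation_one hu, fun v => ⟨v, fun p => mul_left_comm u v p⟩⟩
  · refine ⟨swap (Multiplicative.ofAdd (Pi.single 0 1)) (Multiplicative.ofAdd (Pi.single 1 1)),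
      Perm.sign_swap (by decide), ?_⟩
    intro v
    -- Exchanging the two basis vectors and fixing `0` and their sum is the linear map exchanging
    -- the coordinates, so it carries translation by `v` to translation by the image of `v`.
    refine ⟨swap (Multiplicative.ofAdd (Pi.single 0 1)) (Multiplicative.ofAdd (Pi.single 1 1)) v,
      ?_⟩
    revert v
    decide

theorem exists_odd_normalizing_of_small_block {n : ℕ} {i : ℕ+ →₀ ℕ} (φ : Letters i ↪ Fin n)
    {j : ℕ+} (hj : j = 1 ∨ j = 2) (hij : i j ≠ 0) :
    ∃ τ : Perm (Fin n), Perm.sign τ = -1 ∧ ∀ a ∈ placedGroup i φ, τ * a * τ⁻¹ ∈ placedGroup i φ := by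
  classical
  let k : Blocks i := ⟨j, ⟨0, Nat.pos_of_ne_zero hij⟩⟩
  obtain ⟨σ, hσ, hσn⟩ := exists_odd_normalizing_translations (d := k.1)
    (by rcases hj with rfl | rfl <;> simp [k])
  let ε : VGroup k.1 ↪ Fin n := ⟨fun p => blockEmb φ ⟨k, p⟩,
    emb_mk_injective (ψ := blockEmb φ) k⟩
  refine ⟨σ.viaEmbedding ε, by rw [sign_viaEmbedding, hσ], ?_⟩
  have h1 : ∀ p, σ.viaEmbedding ε (blockEmb φ ⟨k, p⟩) = blockEmb φ ⟨k, σ p⟩ := fun p =>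
    Perm.viaEmbedding_apply σ ε p
  have h2 : ∀ y, (∀ p, y ≠ blockEmb φ ⟨k, p⟩) → σ.viaEmbedding ε y = y := by
    intro y hy
    apply Perm.viaEmbedding_apply_of_notMem
    rintro ⟨p, hp⟩
    exact hy p hp.symm
  intro a ha
  rw [placedGroup_eq] at ha ⊢
  refine ⟨?_, alternatingGroup.normal.conj_mem _ ha.2 _⟩
  obtain ⟨v, rfl⟩ := ha.1
  obtain ⟨w, hw⟩ := hσn (v k)
  -- Conjugation by `σ`, extended by the identity, alters only the translation of block `k`.
  refine ⟨Function.update v k w, ?_⟩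
  rw [eq_mul_inv_iff_mul_eq]
  ext1 y
  rw [Perm.mul_apply, Perm.mul_apply]
  by_cases hr : y ∈ Set.range (blockEmb φ)
  · obtain ⟨⟨l, p⟩, rfl⟩ := hr
    by_cases hl : l = k
    · subst hl
      rw [h1, blockPerm_apply, blockPerm_apply, h1, Function.update_self, hw]
    · have hne : ∀ q q', blockEmb φ ⟨l, q⟩ ≠ blockEmb φ ⟨k, q'⟩ := fun q q' h =>
        hl (congr_arg Sigma.fst ((blockEmb φ).injective h))
      rw [h2 _ (hne p), blockPerm_apply, blockPerm_apply, h2 _ (hne _),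
        Function.update_of_ne hl]
  · have : σ.viaEmbedding ε y = y := h2 y fun p hp => hr ⟨_, hp.symm⟩
    rw [this, blockPerm_apply_of_notMem _ _ hr, blockPerm_apply_of_notMem _ _ hr, this]

theorem conjugateIn_alternatingGroup_of_hasForm {n : ℕ} {i : ℕ+ →₀ ℕ}
    {A B : Subgroup (Perm (Fin n))} (hA : HasForm i A) (hB : HasForm i B)
    (hs : ¬ IsSplittingForm n i) : ConjugateIn (alternatingGroup (Fin n)) A B := by
  have hAB := hA.conjugateIn_top hB
  obtain ⟨φ, rfl⟩ := hA
  have hle := letterCount_le φ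
  by_cases h1 : i 1 = 0
  · by_cases h2 : i 2 = 0
    · by_cases hn : letterCount i + 2 ≤ n
      · have hcard : 1 < (Finset.univ.map φ)ᶜ.card := by
          rw [card_compl_range]
          omega
        obtain ⟨y, hy, z, hz, hyz⟩ := Finset.one_lt_card.1 hcard
        have hy' : y ∉ Set.range φ := by simpa using hy
        have hz' : z ∉ Set.range φ := by simpa using hz
        refine conjugateIn_alternatingGroup_of_odd_normalizes hAB (Perm.sign_swap hyz) ?_
        intro a ha
        rw [swap_mul_eq_mul_swap_of_fixed (placedGroup_apply_of_notMem hy' ha)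
          (placedGroup_apply_of_notMem hz' ha), mul_inv_cancel_right]
        exact ha
      · have hi : i = 0 := by
          by_contra hi
          exact hs ⟨hi, h1, h2, by omega⟩
        subst hi
        obtain ⟨g, -, rfl⟩ := hAB
        have h0 : letterCount 0 = 0 := Finsupp.sum_zero_index
        have : Subsingleton (Fin n) := Fin.subsingleton_iff_le_one.2 (by omega)
        exact ⟨g, by rw [Subsingleton.elim g 1]; exact Subgroup.one_mem _, rfl⟩
    · obtain ⟨τ, hτ, h⟩ := exists_odd_normalizing_of_small_block φ (Or.inr rfl) h2
      exact conjugateIn_alternatingGroup_of_odd_normalizes hAB hτ h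
  · obtain ⟨τ, hτ, h⟩ := exists_odd_normalizing_of_small_block φ (Or.inl rfl) h1
    exact conjugateIn_alternatingGroup_of_odd_normalizes hAB hτ h

theorem form_eq_of_conjugateIn {n : ℕ} {i k : ℕ+ →₀ ℕ} {H A B : Subgroup (Perm (Fin n))}
    (hi : i 1 ≠ 1) (hk : k 1 ≠ 1) (hA : HasForm i A) (hB : HasForm k B)
    (h : ConjugateIn H A B) : i = k := by
  obtain ⟨φ, rfl⟩ := hA
  obtain ⟨φ', rfl⟩ := hB
  obtain ⟨g, -, hg⟩ := h
  rw [placedGroup_conj] at hg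
  exact form_unique hi hk _ _ hg

theorem proposition5p2 (n : ℕ) :
    -- the classification
    (∀ A : Subgroup (Equiv.Perm (Fin n)),
      IsMaxElementaryAbelianTwo (alternatingGroup (Fin n)) A →
      ∃ i : ℕ+ →₀ ℕ, i 1 ≠ 1 ∧
        (∃ B, HasForm i B ∧ ConjugateIn (alternatingGroup (Fin n)) A B) ∧
        (∀ B, HasForm i B → ConjugateIn ⊤ A B) ∧
        (movedLetters A).ncard = letterCount i ∧
        letterCount i ≤ n ∧ n ≤ letterCount i + 3) ∧
    -- the remark: maximality of the groups `V_3 ^ {i_3} × ⋯ × V_r ^ {i_r}` and splitting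
    (∀ (i : ℕ+ →₀ ℕ) (A : Subgroup (Equiv.Perm (Fin n))),
      i ≠ 0 → i 1 = 0 → i 2 = 0 → HasForm i A →
        (n ≤ letterCount i + 1 → IsMaxElementaryAbelianTwo ⊤ A) ∧
        (n ≤ letterCount i + 3 → IsMaxElementaryAbelianTwo (alternatingGroup (Fin n)) A) ∧
        (n ≤ letterCount i + 1 → ClassSplitsInTwo (alternatingGroup (Fin n)) A)) ∧
    -- the remark: all other types
    (∀ (i k : ℕ+ →₀ ℕ) (A B : Subgroup (Equiv.Perm (Fin n))),
      IsMaxElementaryAbelianTwo (alternatingGroup (Fin n)) A →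
      IsMaxElementaryAbelianTwo (alternatingGroup (Fin n)) B →
      HasForm i A → HasForm k B → i 1 ≠ 1 → k 1 ≠ 1 →
      ¬ IsSplittingForm n i → ¬ IsSplittingForm n k →
      (ConjugateIn (alternatingGroup (Fin n)) A B ↔ i = k)) := by
  refine ⟨?_, ?_, ?_⟩
  · intro A hA
    obtain ⟨i, φ, hi, rfl⟩ := exists_form_of_isMax hA
    refine ⟨i, hi, ⟨_, ⟨φ, rfl⟩, 1, Subgroup.one_mem _, ?_⟩,
      fun B hB => HasForm.conjugateIn_top ⟨φ, rfl⟩ hB, ncard_movedLetters hi φ,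
      letterCount_le φ, le_letterCount_add_three hA⟩
    rw [map_one]
    exact Subgroup.map_id _
  · rintro i _ hi hi1 hi2 ⟨φ, rfl⟩
    exact ⟨fun hn => isMax_placedGroup hi1 φ le_top (Or.inl hn),
      fun hn => isMax_placedGroup hi1 φ (placedGroup_le_alternatingGroup i φ)
        (Or.inr ⟨hn, le_rfl⟩),
      fun hn => classSplitsInTwo_placedGroup hi hi1 hi2 φ hn⟩
  · intro i k A B _ _ hA hB hi hk hsi _
    refine ⟨form_eq_of_conjugateIn hi hk hA hB, ?_⟩
    rintro rfl
    exact conjugateIn_alternatingGroup_of_hasForm hA hB hsi
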